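/- Let $\mathbb{N}_0^{\mathbb{N}}$ (resp. $\mathbb{Z}_0^{\mathbb{N}}$) denote the finitely supported sequences of non-negative integers (resp. integers) with entrywise addition. An $\mathbb{N}$-graph is a countable category $\Lambda$, with range and source maps $r,s$ and composition $\lambda\mu$ defined when $s(\lambda)=r(\mu)$, together with a functor $d:\Lambda\to\mathbb{N}_0^{\mathbb{N}}$ such that whenever $d(\lambda)=m+n$ there are unique $\mu,\nu\in\Lambda$ with $\lambda=\mu\nu$, $d(\mu)=m$, $d(\nu)=n$. Write $\Lambda^n=d^{-1}(n)$, identify the objects (vertices) with $\Lambda^0$, put $v\Lambda^n=\{\lambda\in\Lambda^n: r(\lambda)=v\}$, and let $\Lambda^{\neq 0}$ be the set of paths of nonzero degree. $\Lambda$ is row-finite if every $v\Lambda^n$ is finite, and has no source if every $v\Lambda^n$ is nonempty. Let $R$ be a commutative ring with $1$; $R$-algebras are associative and need not be unital. For a row-finite $\mathbb{N}$-graph $\Lambda$, a Kumjian–Pask $\Lambda$-family $(P,S)$ in an $R$-algebra $A$ consists of elements $P_v$ ($v\in\Lambda^0$) and $S_\lambda,S_{\lambda^*}$ ($\lambda\in\Lambda^{\neq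 0}$) of $A$ such that 1. the $P_v$ are mutually orthogonal idempotents; 2. for $\lambda,\mu\in\Lambda^{\neq0}$ with $s(\lambda)=r(\mu)$: $S_\lambda S_\mu=S_{\lambda\mu}$ and $S_{\mu^*}S_{\lambda^*}=S_{(\lambda\mu)^*}$; and for $\lambda\in\Lambda^{\neq0}$: $P_{r(\lambda)}S_\lambda=S_\lambda=S_\lambda P_{s(\lambda)}$ and $P_{s(\lambda)}S_{\lambda^*}=S_{\lambda^*}=S_{\lambda^*}P_{r(\lambda)}$; 3. $S_{\lambda^*}S_\mu=\delta_{\lambda,\mu}P_{s(\lambda)}$ for all $\lambda,\mu\in\Lambda^n$, $n\neq0$; 4. $P_v=\sum_{\lambda\in v\Lambda^n}S_\lambda S_{\lambda^*}$ for all $v\in\Lambda^0$ and $n\neq0$. Theorem. Let $\Lambda$ be a row-finite $\mathbb{N}$-graph with no source, and let $R$ be a commutative ring with $1$. (i) There is an $R$-algebra $KP_R(\Lambda)$, generated by a Kumjian–Pask $\Lambda$-family $(p,s)$, such that for every Kumjian–Pask $\Lambda$-family $(Q,T)$ in an $R$-algebra $A$ there is a unique $R$-algebra homomorphism $\pi_{Q,T}:KP_R(\Lambda)\to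 A$ with $\pi_{Q,T}\circ p=Q$ and $\pi_{Q,T}\circ s=T$. The pair consisting of this algebra and its family is unique up to a unique isomorphism carrying one family to the other. Moreover $rp_v\neq0$ for every $r\in R\setminus\{0\}$ and $v\in\Lambda^0$. (ii) For $n\in\mathbb{Z}_0^{\mathbb{N}}$ put $KP_R(\Lambda)_n:=\operatorname{span}_R\{s_\alpha s_{\beta^*}:\alpha,\beta\in\Lambda,\ d(\alpha)-d(\beta)=n\}$, where $s_v=s_{v^*}=p_v$ for vertices $v$. These submodules form a $\mathbb{Z}_0^{\mathbb{N}}$-grading of $KP_R(\Lambda)$: $KP_R(\Lambda)=\bigoplus_n KP_R(\Lambda)_n$ and $KP_R(\Lambda)_m\,KP_R(\Lambda)_n\subseteq KP_R(\Lambda)_{m+n}$ for all $m,n$. -/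

import Mathlib

open CategoryTheory

universe u v w t

/-- An `ℕ`-graph: a countable category with a degree functor into `ℕ →₀ ℕ` (finitely supported
sequences of natural numbers, regarded as a category with one object) that has the unique
factorization property.

A path `l` is a morphism from its source `s(l)` to its range `r(l)`. The product `l m` of paths,
defined when `s(l) = r(m)`, is therefore the morphism `m ≫ l` in Mathlib's notation.
By unique factorization the morphisms of degree `0` are exactly the identities, so the objects
are the vertices. -/
class NGraph (Λ : Type u) extends Category.{v} Λ where
  countable_hom : Countable (Σ x y : Λ, x ⟶ y)
  deg : ∀ {x y : Λ}, (x ⟶ y) → (ℕ →₀ ℕ)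
  deg_id : ∀ x : Λ, deg (𝟙 x) = 0
  deg_comp : ∀ {x y z : Λ} (m : x ⟶ y) (l : y ⟶ z), deg (m ≫ l) = deg l + deg m
  factorization : ∀ {x z : Λ} (l : x ⟶ z) (m n : ℕ →₀ ℕ), deg l = m + n →
    ∃! q : (Σ y : Λ, (y ⟶ z) × (x ⟶ y)),
      deg q.2.1 = m ∧ deg q.2.2 = n ∧ q.2.2 ≫ q.2.1 = l

namespace NGraph

variable (Λ : Type u) [NGraph.{u, v} Λ]

/-- The set of all paths (morphisms) of the `ℕ`-graph. -/
@[ext]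
structure Path where
  /-- the source of the path -/
  source : Λ
  /-- the range of the path -/
  range : Λ
  /-- the path as a morphism from its source to its range -/
  hom : source ⟶ range

variable {Λ}

/-- The degree of a path. -/
def Path.deg (l : Path Λ) : ℕ →₀ ℕ := NGraph.deg l.hom

/-- The set of paths of degree `n` with range `x`. -/
def pathsInto (x : Λ) (n : ℕ →₀ ℕ) : Set (Path Λ) := {l | l.range = x ∧ l.deg = n}

variable (Λ)

/-- Every vertex receives only finitely many paths of each degree. -/
def RowFinite : Prop := ∀ (x : Λ) (n : ℕ →₀ ℕ), (pathsInto x n).Finite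

/-- Every vertex receives at least one path of each degree. -/
def NoSources : Prop := ∀ (x : Λ) (n : ℕ →₀ ℕ), (pathsInto x n).Nonempty

/-- The paths that are not vertices, i.e. the paths of nonzero degree. -/
def Edge : Type (max u v) := {l : Path Λ // l.deg ≠ 0}

variable {Λ}

/-- A morphism of nonzero degree, as a path that is not a vertex. -/
def Edge.of {x y : Λ} (l : x ⟶ y) (hl : deg l ≠ 0) : Edge Λ := ⟨⟨x, y, l⟩, hl⟩

theorem deg_comp_ne_zero {x y z : Λ} (m : x ⟶ y) (l : y ⟶ z) (hl : deg l ≠ 0) :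
    deg (m ≫ l) ≠ 0 := by
  intro h
  rw [deg_comp, add_eq_zero] at h
  exact hl h.1

end NGraph

open NGraph

open scoped Classical in
/-- A Kumjian–Pask `Λ`-family in a (not necessarily unital) algebra `A`, for a row-finite
`ℕ`-graph `Λ`. The function on nontrivial paths and nontrivial ghost paths is given by its two
restrictions `S` (paths) and `S'` (ghost paths), so `S' l` stands for `S_{l^*}`.
The sums in `kp4` are finite because `Λ` is row-finite. -/
structure KumjianPaskFamily (Λ : Type u) [NGraph.{u, v} Λ] (A : Type w) [NonUnitalRing A] where
  P : Λ → A
  S : Edge Λ → A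
  S' : Edge Λ → A
  kp1_idem : ∀ x, P x * P x = P x
  kp1_orth : ∀ x y, x ≠ y → P x * P y = 0
  kp2_mul : ∀ {x y z : Λ} (m : x ⟶ y) (l : y ⟶ z) (hm : deg m ≠ 0) (hl : deg l ≠ 0),
    S (Edge.of l hl) * S (Edge.of m hm) = S (Edge.of (m ≫ l) (deg_comp_ne_zero m l hl))
  kp2_mul_ghost : ∀ {x y z : Λ} (m : x ⟶ y) (l : y ⟶ z) (hm : deg m ≠ 0) (hl : deg l ≠ 0),
    S' (Edge.of m hm) * S' (Edge.of l hl) = S' (Edge.of (m ≫ l) (deg_comp_ne_zero m l hl))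
  kp2_range : ∀ l : Edge Λ, P l.1.range * S l = S l
  kp2_source : ∀ l : Edge Λ, S l * P l.1.source = S l
  kp2_range_ghost : ∀ l : Edge Λ, P l.1.source * S' l = S' l
  kp2_source_ghost : ∀ l : Edge Λ, S' l * P l.1.range = S' l
  kp3 : ∀ l m : Edge Λ, l.1.deg = m.1.deg → S' l * S m = if l = m then P l.1.source else 0
  kp4 : ∀ (x : Λ) (n : ℕ →₀ ℕ), n ≠ 0 →
    P x = ∑ᶠ l : {l : Edge Λ // l.1 ∈ pathsInto x n}, S l.1 * S' l.1

namespace KumjianPaskFamily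

variable {Λ : Type u} [NGraph.{u, v} Λ]

open scoped Classical in
/-- `s_l` for an arbitrary path `l`, with `s_x = p_x` for a vertex `x`. -/
noncomputable def path {A : Type w} [NonUnitalRing A] (F : KumjianPaskFamily Λ A)
    (l : Path Λ) : A :=
  if h : l.deg ≠ 0 then F.S ⟨l, h⟩ else F.P l.source

open scoped Classical in
/-- `s_{l^*}` for an arbitrary path `l`, with `s_{x^*} = p_x` for a vertex `x`. -/
noncomputable def ghost {A : Type w} [NonUnitalRing A] (F : KumjianPaskFamily Λ A)
    (l : Path Λ) : A :=
  if h : l.deg ≠ 0 then F.S' ⟨l, h⟩ else F.P l.source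

/-- The map `f` carries the family `F` to the family `G`. -/
def MapsTo {R : Type t} [CommRing R] {A B : Type*} [NonUnitalRing A] [Module R A]
    [NonUnitalRing B] [Module R B] (F : KumjianPaskFamily Λ A) (G : KumjianPaskFamily Λ B)
    (f : A →ₙₐ[R] B) : Prop :=
  (∀ x, f (F.P x) = G.P x) ∧ (∀ l, f (F.S l) = G.S l) ∧ (∀ l, f (F.S' l) = G.S' l)

variable (R : Type t) [CommRing R]

/-- The family generates the `R`-algebra `A`. -/
def Generates {A : Type w} [NonUnitalRing A] [Module R A] [IsScalarTower R A A]
    [SMulCommClass R A A] (F : KumjianPaskFamily Λ A) : Prop :=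
  NonUnitalAlgebra.adjoin R (Set.range F.P ∪ Set.range F.S ∪ Set.range F.S') = ⊤

/-- The universal property of a family `F` in an `R`-algebra `K`: for every family `G` in an
`R`-algebra `A` (in the universe `w`) there is a unique `R`-algebra homomorphism `K → A` that
carries `F` to `G`. -/
def IsUniversal {K : Type*} [NonUnitalRing K] [Module R K] (F : KumjianPaskFamily Λ K) : Prop :=
  ∀ (A : Type w) [NonUnitalRing A] [Module R A] [IsScalarTower R A A] [SMulCommClass R A A]
    (G : KumjianPaskFamily Λ A), ∃! f : K →ₙₐ[R] A, F.MapsTo G f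

/-- The `R`-span of the elements `s_a s_{b^*}` with `d(a) - d(b) = n`. -/
def component {A : Type w} [NonUnitalRing A] [Module R A] (F : KumjianPaskFamily Λ A)
    (n : ℕ →₀ ℤ) : Submodule R A :=
  Submodule.span R
    {c | ∃ a b : Path Λ, (∀ i, (a.deg i : ℤ) - (b.deg i : ℤ) = n i) ∧ c = F.path a * F.ghost b}

end KumjianPaskFamily

/-!
A Kumjian–Pask family is the same as a pair of functions on all paths, vertices included, that
satisfies the relations without any restriction on the degrees; this form has no case distinctions.
The algebra is the non-unital subalgebra generated by the paths and ghost paths in the unital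
algebra presented by these relations. It is universal for non-unital algebras `A` as well: a family
in `A` is one in the unitization of `A`, and the homomorphism that it induces maps the generators,
hence the whole subalgebra, into the ideal `A`.

The vertex idempotents have no annihilator because the paths act on germs at infinity of functions
on paths: since there are no sources, the germ of the constant function `1` survives at each vertex.

Products of components are computed by expanding `s_{b^*} s_c` at the common degree
`d(b) ⊔ d(c)`, where all summands but those with `b l = c m` vanish. The components are independent
because twisting the universal family by the degree gives a homomorphism into the group algebra of
`ℕ →₀ ℤ` that maps the component of degree `n` injectively to the part supported at `n`.
-/

universe w'

theorem iSupIndep_of_forall_eq_single {R ι M N : Type*} [Semiring R] [AddCommMonoid M] [Module R M]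
    [AddCommMonoid N] [Module R N] {p : ι → Submodule R M} (f : M →ₗ[R] ι →₀ N) {j : M → N}
    (hj : ∀ a, j a = 0 → a = 0) (hf : ∀ i, ∀ a ∈ p i, f a = Finsupp.single i (j a)) :
    iSupIndep p := by
  intro i
  rw [Submodule.disjoint_def]
  intro a ha ha'
  have hker : ⨆ k, ⨆ (_ : k ≠ i), p k ≤ LinearMap.ker (Finsupp.lapply i ∘ₗ f) := by
    refine iSup₂_le fun k hk b hb => ?_
    rw [LinearMap.mem_ker, LinearMap.comp_apply, Finsupp.lapply_apply, hf k b hb,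
      Finsupp.single_eq_of_ne hk.symm]
  have hzero : f a i = 0 := hker ha'
  rw [hf i a ha, Finsupp.single_eq_same] at hzero
  exact hj a hzero

theorem adjoin_preimage_coe_eq_top (R : Type*) {A : Type*} [CommSemiring R]
    [NonUnitalNonAssocSemiring A] [Module R A] [IsScalarTower R A A] [SMulCommClass R A A]
    (s : Set A) : NonUnitalAlgebra.adjoin R
      ((↑) ⁻¹' s : Set (NonUnitalAlgebra.adjoin R s)) = ⊤ := by
  let j := NonUnitalSubalgebraClass.subtype (NonUnitalAlgebra.adjoin R s)
  have hmap : (NonUnitalAlgebra.adjoin R (j ⁻¹' s)).map j = NonUnitalAlgebra.adjoin R s := by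
    rw [NonUnitalAlgHom.map_adjoin, Set.image_preimage_eq_of_subset]
    exact fun a ha => ⟨⟨a, NonUnitalAlgebra.subset_adjoin R ha⟩, rfl⟩
  refine eq_top_iff.2 fun a _ => ?_
  obtain ⟨b, hb, hba⟩ : a.1 ∈ (NonUnitalAlgebra.adjoin R (j ⁻¹' s)).map j := hmap.ge a.2
  rwa [← Subtype.ext (a1 := b) (a2 := a) hba]

theorem exists_inr_eq_of_fst_eq_zero {R A K : Type*} [CommRing R] [NonUnitalRing A] [Module R A]
    [NonUnitalRing K] [Module R K] (f : K →ₙₐ[R] Unitization R A) (hf : ∀ a, (f a).fst = 0) :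
    ∃ g : K →ₙₐ[R] A, ∀ a, (g a : Unitization R A) = f a :=
  ⟨{ toFun a := (f a).snd
     map_smul' r a := by simp
     map_zero' := by simp
     map_add' a b := by simp
     map_mul' a b := by simp [hf] },
    fun a => Unitization.ext (by simp [hf]) (by simp)⟩

namespace NGraph

variable {Λ : Type u} [NGraph.{u, v} Λ]

namespace Path

/-- The vertex `x` as a path of degree zero. -/
def vertex (x : Λ) : Path Λ := ⟨x, x, 𝟙 x⟩

/-- The product `l m` of two composable paths. The equation `m.range = l.source` is a hypothesis,
so that paths with propositionally equal endpoints can be composed. -/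
def comp (l m : Path Λ) (h : m.range = l.source) : Path Λ :=
  ⟨m.source, l.range, m.hom ≫ eqToHom h ≫ l.hom⟩

@[simp] theorem vertex_source (x : Λ) : (vertex x).source = x := rfl

@[simp] theorem vertex_range (x : Λ) : (vertex x).range = x := rfl

@[simp] theorem deg_vertex (x : Λ) : (vertex x).deg = 0 := deg_id x

@[simp] theorem comp_source (l m : Path Λ) (h : m.range = l.source) :
    (l.comp m h).source = m.source := rfl

theorem comp_mk {x y z : Λ} (l : y ⟶ z) (m : x ⟶ y) :
    comp ⟨y, z, l⟩ ⟨x, y, m⟩ rfl = ⟨x, z, m ≫ l⟩ := by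
  simp [comp]

@[simp] theorem deg_comp (l m : Path Λ) (h : m.range = l.source) :
    (l.comp m h).deg = l.deg + m.deg := by
  obtain ⟨x, y, m⟩ := m
  obtain ⟨y', z, l⟩ := l
  obtain rfl : y = y' := h
  rw [comp_mk]
  exact NGraph.deg_comp m l

theorem comp_assoc (k l m : Path Λ) (h : l.range = k.source) (h' : m.range = l.source) :
    (k.comp l h).comp m h' = k.comp (l.comp m h') h := by
  simp [comp]

@[simp] theorem comp_vertex (l : Path Λ) : l.comp (vertex l.source) rfl = l := by
  simp [comp, vertex]

@[simp] theorem vertex_comp (l : Path Λ) : (vertex l.range).comp l rfl = l := by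
  simp [comp, vertex]

theorem exists_comp_eq (p : Path Λ) {m n : ℕ →₀ ℕ} (h : p.deg = m + n) :
    ∃ (a b : Path Λ) (hab : b.range = a.source), a.deg = m ∧ b.deg = n ∧ a.comp b hab = p := by
  obtain ⟨⟨y, a, b⟩, ⟨ha, hb, hab⟩, -⟩ := factorization p.hom m n h
  refine ⟨⟨y, p.range, a⟩, ⟨p.source, y, b⟩, rfl, ha, hb, ?_⟩
  rw [comp_mk]
  exact congrArg (Path.mk p.source p.range) hab

theorem comp_inj_of_deg_eq {a b a' b' : Path Λ} {h : b.range = a.source}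
    {h' : b'.range = a'.source} (hd : a.deg = a'.deg) (he : a.comp b h = a'.comp b' h') :
    a = a' ∧ b = b' := by
  have hd' : b.deg = b'.deg := by simpa [hd] using congrArg Path.deg he
  obtain ⟨x, y, b⟩ := b
  obtain ⟨y₁, z, a⟩ := a
  obtain rfl : y = y₁ := h
  obtain ⟨x', y', b'⟩ := b'
  obtain ⟨y₁', z', a'⟩ := a'
  obtain rfl : y' = y₁' := h'
  rw [comp_mk, comp_mk, Path.mk.injEq] at he
  obtain ⟨rfl, rfl, he⟩ := he
  have huniq := (factorization (b ≫ a) _ _ (NGraph.deg_comp b a)).unique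
    (y₁ := ⟨y, a, b⟩) (y₂ := ⟨y', a', b'⟩) ⟨rfl, rfl, rfl⟩ ⟨hd.symm, hd'.symm, (eq_of_heq he).symm⟩
  cases huniq
  exact ⟨rfl, rfl⟩

theorem exists_eq_vertex_of_deg_eq_zero {l : Path Λ} (h : l.deg = 0) : ∃ x, l = vertex x :=
  have hcomp : (vertex l.range).comp l rfl = l.comp (vertex l.source) rfl := by simp
  ⟨l.range, (comp_inj_of_deg_eq (by simp [h]) hcomp).1.symm⟩

theorem exists_eq_vertex_or_edge (l : Path Λ) : (∃ x, l = vertex x) ∨ ∃ e : Edge Λ, l = e.1 :=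
  (eq_or_ne l.deg 0).imp exists_eq_vertex_of_deg_eq_zero fun h => ⟨⟨l, h⟩, rfl⟩

/-- The degree of a path as an integer sequence. -/
noncomputable def intDeg (l : Path Λ) : ℕ →₀ ℤ := l.deg.mapRange Nat.cast Nat.cast_zero

@[simp] theorem intDeg_apply (l : Path Λ) (i : ℕ) : l.intDeg i = l.deg i :=
  Finsupp.mapRange_apply ..

@[simp] theorem intDeg_vertex (x : Λ) : (vertex x).intDeg = 0 := by
  ext i
  simp

@[simp] theorem intDeg_comp (l m : Path Λ) (h : m.range = l.source) :
    (l.comp m h).intDeg = l.intDeg + m.intDeg := by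
  ext i
  simp

end Path

theorem pathsInto_zero (x : Λ) : pathsInto x 0 = {Path.vertex x} := by
  ext l
  constructor
  · rintro ⟨rfl, h⟩
    obtain ⟨x, rfl⟩ := Path.exists_eq_vertex_of_deg_eq_zero h
    rfl
  · rintro rfl
    exact ⟨rfl, Path.deg_vertex x⟩

theorem finsum_edge_mem_pathsInto {M : Type*} [AddCommMonoid M] (x : Λ) {n : ℕ →₀ ℕ} (hn : n ≠ 0)
    (f : Path Λ → M) :
    ∑ᶠ l : {l : Edge Λ // l.1 ∈ pathsInto x n}, f l.1.1 = ∑ᶠ l ∈ pathsInto x n, f l := by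
  rw [← finsum_set_coe_eq_finsum_mem]
  refine finsum_eq_of_bijective (fun l => ⟨l.1.1, l.2⟩) ⟨fun l m h => ?_, fun l => ?_⟩ fun _ => rfl
  · exact Subtype.ext (Subtype.ext (Subtype.mk.inj h))
  · exact ⟨⟨⟨l.1, l.2.2.trans_ne hn⟩, l.2⟩, rfl⟩

/-- The Kumjian–Pask relations for a pair of functions `s`, `s'` on all paths, vertices included:
`s l` and `s' l` stand for `s_l` and `s_{l^*}`, and the common value of `s` and `s'` at a vertex is
the vertex idempotent. -/
structure IsKumjianPask {A : Type*} [NonUnitalRing A] (s s' : Path Λ → A) : Prop where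
  path_mul_path : ∀ (l m : Path Λ) (h : m.range = l.source), s l * s m = s (l.comp m h)
  ghost_mul_ghost : ∀ (l m : Path Λ) (h : m.range = l.source), s' m * s' l = s' (l.comp m h)
  ghost_vertex : ∀ x, s' (.vertex x) = s (.vertex x)
  ghost_mul_path_self : ∀ l, s' l * s l = s (.vertex l.source)
  ghost_mul_path_of_ne : ∀ l m : Path Λ, l.deg = m.deg → l ≠ m → s' l * s m = 0
  vertex_eq_finsum : ∀ x n, s (.vertex x) = ∑ᶠ l ∈ pathsInto x n, s l * s' l

namespace IsKumjianPask

variable {A B : Type*} [NonUnitalRing A] [NonUnitalRing B] {s s' : Path Λ → A}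

theorem map (h : IsKumjianPask s s') (hfin : RowFinite Λ) {F : Type*} [FunLike F A B]
    [NonUnitalRingHomClass F A B] (f : F) :
    IsKumjianPask (fun l => f (s l)) (fun l => f (s' l)) where
  path_mul_path l m hlm := by rw [← map_mul, h.path_mul_path]
  ghost_mul_ghost l m hlm := by rw [← map_mul, h.ghost_mul_ghost]
  ghost_vertex x := by rw [h.ghost_vertex]
  ghost_mul_path_self l := by rw [← map_mul, h.ghost_mul_path_self]
  ghost_mul_path_of_ne l m hd hne := by rw [← map_mul, h.ghost_mul_path_of_ne l m hd hne, map_zero]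
  vertex_eq_finsum x n := by
    rw [h.vertex_eq_finsum x n]
    exact ((AddMonoidHomClass.toAddMonoidHom f).map_finsum_mem _ (hfin x n)).trans <|
      finsum_mem_congr rfl fun l _ => map_mul f _ _

theorem of_injective (hfin : RowFinite Λ) {F : Type*} [FunLike F A B] [NonUnitalRingHomClass F A B]
    (f : F) (hf : Function.Injective f)
    (h : IsKumjianPask (fun l => f (s l)) (fun l => f (s' l))) : IsKumjianPask s s' where
  path_mul_path l m hlm := hf (by rw [map_mul, h.path_mul_path])
  ghost_mul_ghost l m hlm := hf (by rw [map_mul, h.ghost_mul_ghost])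
  ghost_vertex x := hf (h.ghost_vertex x)
  ghost_mul_path_self l := hf (by rw [map_mul, h.ghost_mul_path_self])
  ghost_mul_path_of_ne l m hd hne := hf <| by
    rw [map_mul, h.ghost_mul_path_of_ne l m hd hne, map_zero]
  vertex_eq_finsum x n := hf <| (h.vertex_eq_finsum x n).trans <| .symm <|
    ((AddMonoidHomClass.toAddMonoidHom f).map_finsum_mem _ (hfin x n)).trans <|
      finsum_mem_congr rfl fun l _ => map_mul f _ _

/-- The Kumjian–Pask family given by the restrictions of `s` and `s'` to the vertices and to the
nontrivial paths. -/
def toFamily (h : IsKumjianPask s s') : KumjianPaskFamily Λ A where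
  P x := s (.vertex x)
  S l := s l.1
  S' l := s' l.1
  kp1_idem x := (h.path_mul_path _ _ rfl).trans <| congrArg s (Path.comp_vertex (.vertex x))
  kp1_orth x y hxy := by
    rw [← h.ghost_vertex]
    exact h.ghost_mul_path_of_ne _ _ (by simp) fun e => hxy (congrArg Path.source e)
  kp2_mul m l _ _ := (h.path_mul_path ⟨_, _, l⟩ ⟨_, _, m⟩ rfl).trans <|
    congrArg s (Path.comp_mk l m)
  kp2_mul_ghost m l _ _ := (h.ghost_mul_ghost ⟨_, _, l⟩ ⟨_, _, m⟩ rfl).trans <|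
    congrArg s' (Path.comp_mk l m)
  kp2_range l := by simpa using h.path_mul_path (.vertex l.1.range) l.1 rfl
  kp2_source l := by simpa using h.path_mul_path l.1 (.vertex l.1.source) rfl
  kp2_range_ghost l := by
    simpa [h.ghost_vertex] using h.ghost_mul_ghost l.1 (.vertex l.1.source) rfl
  kp2_source_ghost l := by
    simpa [h.ghost_vertex] using h.ghost_mul_ghost (.vertex l.1.range) l.1 rfl
  kp3 l m hd := by
    split_ifs with hlm
    · rw [hlm, h.ghost_mul_path_self]
    · exact h.ghost_mul_path_of_ne _ _ hd fun e => hlm (Subtype.ext e)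
  kp4 x n hn := (h.vertex_eq_finsum x n).trans (finsum_edge_mem_pathsInto x hn _).symm

end IsKumjianPask

end NGraph

namespace KumjianPaskFamily

variable {Λ : Type u} [NGraph.{u, v} Λ]

section Paths

variable {A : Type*} [NonUnitalRing A] (F : KumjianPaskFamily Λ A)

@[simp] theorem path_edge (l : Edge Λ) : F.path l.1 = F.S l := dif_pos l.2

@[simp] theorem ghost_edge (l : Edge Λ) : F.ghost l.1 = F.S' l := dif_pos l.2

@[simp] theorem path_vertex (x : Λ) : F.path (.vertex x) = F.P x := by simp [path]

@[simp] theorem ghost_vertex (x : Λ) : F.ghost (.vertex x) = F.P x := by simp [ghost]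

theorem range_mul_path (l : Path Λ) : F.P l.range * F.path l = F.path l := by
  obtain ⟨x, rfl⟩ | ⟨e, rfl⟩ := l.exists_eq_vertex_or_edge
  · simp [F.kp1_idem]
  · rw [path_edge, F.kp2_range]

theorem path_mul_source (l : Path Λ) : F.path l * F.P l.source = F.path l := by
  obtain ⟨x, rfl⟩ | ⟨e, rfl⟩ := l.exists_eq_vertex_or_edge
  · simp [F.kp1_idem]
  · rw [path_edge, F.kp2_source]

theorem source_mul_ghost (l : Path Λ) : F.P l.source * F.ghost l = F.ghost l := by
  obtain ⟨x, rfl⟩ | ⟨e, rfl⟩ := l.exists_eq_vertex_or_edge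
  · simp [F.kp1_idem]
  · rw [ghost_edge, F.kp2_range_ghost]

theorem ghost_mul_range (l : Path Λ) : F.ghost l * F.P l.range = F.ghost l := by
  obtain ⟨x, rfl⟩ | ⟨e, rfl⟩ := l.exists_eq_vertex_or_edge
  · simp [F.kp1_idem]
  · rw [ghost_edge, F.kp2_source_ghost]

theorem path_mul_path (l m : Path Λ) (h : m.range = l.source) :
    F.path l * F.path m = F.path (l.comp m h) := by
  by_cases hl : l.deg = 0
  · obtain ⟨x, rfl⟩ := Path.exists_eq_vertex_of_deg_eq_zero hl
    obtain rfl : m.range = x := h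
    rw [path_vertex, range_mul_path, Path.vertex_comp]
  by_cases hm : m.deg = 0
  · obtain ⟨x, rfl⟩ := Path.exists_eq_vertex_of_deg_eq_zero hm
    obtain rfl : x = l.source := h
    rw [path_vertex, path_mul_source, Path.comp_vertex]
  obtain ⟨x, y, m⟩ := m
  obtain ⟨y', z, l⟩ := l
  obtain rfl : y = y' := h
  rw [Path.comp_mk]
  have hkp := F.kp2_mul m l hm hl
  rwa [← path_edge, ← path_edge, ← path_edge] at hkp

theorem ghost_mul_ghost (l m : Path Λ) (h : m.range = l.source) :
    F.ghost m * F.ghost l = F.ghost (l.comp m h) := by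
  by_cases hl : l.deg = 0
  · obtain ⟨x, rfl⟩ := Path.exists_eq_vertex_of_deg_eq_zero hl
    obtain rfl : m.range = x := h
    rw [ghost_vertex, ghost_mul_range, Path.vertex_comp]
  by_cases hm : m.deg = 0
  · obtain ⟨x, rfl⟩ := Path.exists_eq_vertex_of_deg_eq_zero hm
    obtain rfl : x = l.source := h
    rw [ghost_vertex, source_mul_ghost, Path.comp_vertex]
  obtain ⟨x, y, m⟩ := m
  obtain ⟨y', z, l⟩ := l
  obtain rfl : y = y' := h
  rw [Path.comp_mk]
  have hkp := F.kp2_mul_ghost m l hm hl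
  rwa [← ghost_edge, ← ghost_edge, ← ghost_edge] at hkp

theorem path_mul_path_of_ne {l m : Path Λ} (h : m.range ≠ l.source) : F.path l * F.path m = 0 := by
  rw [← F.path_mul_source l, ← F.range_mul_path m, mul_assoc, ← mul_assoc (F.P l.source),
    F.kp1_orth _ _ h.symm, zero_mul, mul_zero]

theorem ghost_mul_ghost_of_ne {l m : Path Λ} (h : m.range ≠ l.source) :
    F.ghost m * F.ghost l = 0 := by
  rw [← F.ghost_mul_range m, ← F.source_mul_ghost l, mul_assoc, ← mul_assoc (F.P m.range),
    F.kp1_orth _ _ h, zero_mul, mul_zero]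

theorem ghost_mul_path_self (l : Path Λ) : F.ghost l * F.path l = F.P l.source := by
  obtain ⟨x, rfl⟩ | ⟨e, rfl⟩ := l.exists_eq_vertex_or_edge
  · simp [F.kp1_idem]
  · rw [path_edge, ghost_edge, F.kp3 e e rfl, if_pos rfl]

theorem ghost_mul_path_of_ne {l m : Path Λ} (hd : l.deg = m.deg) (hne : l ≠ m) :
    F.ghost l * F.path m = 0 := by
  obtain ⟨x, rfl⟩ | ⟨e, rfl⟩ := l.exists_eq_vertex_or_edge
  · obtain ⟨y, rfl⟩ := Path.exists_eq_vertex_of_deg_eq_zero (hd.symm.trans (Path.deg_vertex x))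
    rw [ghost_vertex, path_vertex, F.kp1_orth x y fun e => hne (e ▸ rfl)]
  · obtain ⟨m, rfl⟩ : ∃ e' : Edge Λ, m = e'.1 := ⟨⟨m, hd ▸ e.2⟩, rfl⟩
    have hne' : e ≠ m := fun h => hne (congrArg Subtype.val h)
    rw [path_edge, ghost_edge, F.kp3 e m hd, if_neg hne']

theorem P_eq_finsum (x : Λ) (n : ℕ →₀ ℕ) :
    F.P x = ∑ᶠ l ∈ pathsInto x n, F.path l * F.ghost l := by
  obtain rfl | hn := eq_or_ne n 0
  · rw [pathsInto_zero, finsum_mem_singleton, path_vertex, ghost_vertex, F.kp1_idem]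
  · rw [F.kp4 x n hn, ← finsum_edge_mem_pathsInto x hn]
    simp only [path_edge, ghost_edge]

theorem isKumjianPask : IsKumjianPask F.path F.ghost where
  path_mul_path := F.path_mul_path
  ghost_mul_ghost := F.ghost_mul_ghost
  ghost_vertex x := by rw [path_vertex, ghost_vertex]
  ghost_mul_path_self l := by rw [ghost_mul_path_self, path_vertex]
  ghost_mul_path_of_ne _ _ := F.ghost_mul_path_of_ne
  vertex_eq_finsum x n := by rw [path_vertex, ← P_eq_finsum]

theorem range_union : Set.range F.P ∪ Set.range F.S ∪ Set.range F.S' =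
    Set.range F.path ∪ Set.range F.ghost := by
  refine Set.Subset.antisymm ?_ ?_
  · rintro _ ((⟨x, rfl⟩ | ⟨l, rfl⟩) | ⟨l, rfl⟩)
    · exact .inl ⟨_, F.path_vertex x⟩
    · exact .inl ⟨_, F.path_edge l⟩
    · exact .inr ⟨_, F.ghost_edge l⟩
  · rintro _ (⟨l, rfl⟩ | ⟨l, rfl⟩) <;>
      obtain ⟨x, rfl⟩ | ⟨e, rfl⟩ := l.exists_eq_vertex_or_edge
    · exact .inl (.inl ⟨x, (F.path_vertex x).symm⟩)
    · exact .inl (.inr ⟨e, (F.path_edge e).symm⟩)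
    · exact .inl (.inl ⟨x, (F.ghost_vertex x).symm⟩)
    · exact .inr ⟨e, (F.ghost_edge e).symm⟩

end Paths

end KumjianPaskFamily

namespace NGraph.IsKumjianPask

variable {Λ : Type u} [NGraph.{u, v} Λ] {A : Type*} [NonUnitalRing A] {s s' : Path Λ → A}

theorem path_toFamily (h : IsKumjianPask s s') (l : Path Λ) : h.toFamily.path l = s l := by
  obtain ⟨x, rfl⟩ | ⟨e, rfl⟩ := l.exists_eq_vertex_or_edge
  · rw [KumjianPaskFamily.path_vertex, toFamily]
  · exact h.toFamily.path_edge e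

theorem ghost_toFamily (h : IsKumjianPask s s') (l : Path Λ) : h.toFamily.ghost l = s' l := by
  obtain ⟨x, rfl⟩ | ⟨e, rfl⟩ := l.exists_eq_vertex_or_edge
  · rw [KumjianPaskFamily.ghost_vertex, h.ghost_vertex, toFamily]
  · exact h.toFamily.ghost_edge e

end NGraph.IsKumjianPask

namespace KumjianPaskFamily

variable {Λ : Type u} [NGraph.{u, v} Λ]

section Homomorphisms

variable {R : Type t} [CommRing R] {A B : Type*} [NonUnitalRing A] [Module R A]
  [NonUnitalRing B] [Module R B]
  {F : KumjianPaskFamily Λ A} {G : KumjianPaskFamily Λ B}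

theorem mapsTo_iff {f : A →ₙₐ[R] B} :
    F.MapsTo G f ↔ (∀ l, f (F.path l) = G.path l) ∧ ∀ l, f (F.ghost l) = G.ghost l := by
  constructor
  · rintro ⟨hP, hS, hS'⟩
    refine ⟨fun l => ?_, fun l => ?_⟩ <;> obtain ⟨x, rfl⟩ | ⟨e, rfl⟩ := l.exists_eq_vertex_or_edge
    · rw [path_vertex, path_vertex, hP]
    · rw [path_edge, path_edge, hS]
    · rw [ghost_vertex, ghost_vertex, hP]
    · rw [ghost_edge, ghost_edge, hS']
  · rintro ⟨hpath, hghost⟩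
    refine ⟨fun x => ?_, fun e => ?_, fun e => ?_⟩
    · rw [← path_vertex, ← path_vertex, hpath]
    · rw [← path_edge, ← path_edge, hpath]
    · rw [← ghost_edge, ← ghost_edge, hghost]

theorem MapsTo.path {f : A →ₙₐ[R] B} (hf : F.MapsTo G f) (l : Path Λ) :
    f (F.path l) = G.path l :=
  (mapsTo_iff.1 hf).1 l

theorem MapsTo.ghost {f : A →ₙₐ[R] B} (hf : F.MapsTo G f) (l : Path Λ) :
    f (F.ghost l) = G.ghost l :=
  (mapsTo_iff.1 hf).2 l

theorem mapsTo_toFamily {s s' : Path Λ → B} (h : IsKumjianPask s s') {f : A →ₙₐ[R] B} :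
    F.MapsTo h.toFamily f ↔ (∀ l, f (F.path l) = s l) ∧ ∀ l, f (F.ghost l) = s' l := by
  simp only [mapsTo_iff, h.path_toFamily, h.ghost_toFamily]

theorem generates_iff_adjoin_path_ghost [IsScalarTower R A A] [SMulCommClass R A A] :
    F.Generates R ↔ NonUnitalAlgebra.adjoin R (Set.range F.path ∪ Set.range F.ghost) = ⊤ := by
  rw [Generates, range_union]

theorem Generates.hom_ext [IsScalarTower R A A] [SMulCommClass R A A] (hF : F.Generates R)
    {f g : A →ₙₐ[R] B} (hpath : ∀ l, f (F.path l) = g (F.path l))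
    (hghost : ∀ l, f (F.ghost l) = g (F.ghost l)) : f = g := by
  have hle : NonUnitalAlgebra.adjoin R (Set.range F.path ∪ Set.range F.ghost) ≤
      NonUnitalAlgHom.equalizer f g := by
    refine NonUnitalAlgebra.adjoin_le ?_
    rintro _ (⟨l, rfl⟩ | ⟨l, rfl⟩)
    exacts [hpath l, hghost l]
  rw [generates_iff_adjoin_path_ghost.1 hF] at hle
  exact NonUnitalAlgHom.ext fun a => hle (NonUnitalAlgebra.mem_top (x := a))

theorem Generates.mapsTo_unique [IsScalarTower R A A] [SMulCommClass R A A] (hF : F.Generates R)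
    {f g : A →ₙₐ[R] B} (hf : F.MapsTo G f) (hg : F.MapsTo G g) : f = g :=
  hF.hom_ext (fun l => (hf.path l).trans (hg.path l).symm)
    fun l => (hf.ghost l).trans (hg.ghost l).symm

theorem Generates.surjective [IsScalarTower R B B] [SMulCommClass R B B] (hG : G.Generates R)
    {f : A →ₙₐ[R] B} (hf : F.MapsTo G f) : Function.Surjective f := by
  have hle : NonUnitalAlgebra.adjoin R (Set.range G.path ∪ Set.range G.ghost) ≤
      NonUnitalAlgHom.range f := by
    refine NonUnitalAlgebra.adjoin_le ?_
    rintro _ (⟨l, rfl⟩ | ⟨l, rfl⟩)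
    exacts [⟨_, hf.path l⟩, ⟨_, hf.ghost l⟩]
  rw [generates_iff_adjoin_path_ghost.1 hG] at hle
  exact fun b => hle (NonUnitalAlgebra.mem_top (x := b))

end Homomorphisms

theorem IsUniversal.injective {R : Type t} [CommRing R] {A : Type w} [NonUnitalRing A]
    [Module R A] [IsScalarTower R A A] [SMulCommClass R A A] {B : Type w'} [NonUnitalRing B]
    [Module R B] [IsScalarTower R B B] [SMulCommClass R B B] {F : KumjianPaskFamily Λ A}
    {G : KumjianPaskFamily Λ B} (hG : IsUniversal.{u, v, max w w', t} R G) (hfin : RowFinite Λ)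
    (hF : F.Generates R) {f : A →ₙₐ[R] B} (hf : F.MapsTo G f) : Function.Injective f := by
  -- The factor `B` only raises the universe of `A` to the one in which `G` is universal.
  obtain ⟨g, hg, -⟩ := hG (A × B) (F.isKumjianPask.map hfin (NonUnitalAlgHom.inl R A B)).toFamily
  rw [mapsTo_toFamily] at hg
  have hid : ((NonUnitalAlgHom.fst R A B).comp g).comp f = NonUnitalAlgHom.id R A :=
    hF.hom_ext (fun l => congrArg Prod.fst ((congrArg g (hf.path l)).trans (hg.1 l)))
      fun l => congrArg Prod.fst ((congrArg g (hf.ghost l)).trans (hg.2 l))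
  exact Function.LeftInverse.injective (g := (NonUnitalAlgHom.fst R A B).comp g) <|
    DFunLike.congr_fun hid

section Grading

variable {R : Type t} [CommRing R] {A : Type w} [NonUnitalRing A] [Module R A]
  (F : KumjianPaskFamily Λ A)

theorem ghost_mul_path_mem (hfin : RowFinite Λ) {b c : Path Λ} {N : AddSubmonoid A}
    (hN : ∀ l m hl hm, b.comp l hl = c.comp m hm → F.path l * F.ghost m ∈ N) :
    F.ghost b * F.path c ∈ N := by
  -- Expanding both sources moves `b` and `c` to the common degree `b.deg ⊔ c.deg`.
  set n := b.deg ⊔ c.deg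
  have hb : F.ghost b = ∑ l ∈ (hfin b.source (n - b.deg)).toFinset,
      F.path l * F.ghost l * F.ghost b := by
    rw [← Finset.sum_mul, ← finsum_mem_eq_finite_toFinset_sum, ← P_eq_finsum, source_mul_ghost]
  have hc : F.path c = ∑ m ∈ (hfin c.source (n - c.deg)).toFinset,
      F.path c * (F.path m * F.ghost m) := by
    rw [← Finset.mul_sum, ← finsum_mem_eq_finite_toFinset_sum, ← P_eq_finsum, path_mul_source]
  have hexpand : F.ghost b * F.path c =
      ∑ l ∈ (hfin b.source (n - b.deg)).toFinset, ∑ m ∈ (hfin c.source (n - c.deg)).toFinset,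
        F.path l * (F.ghost l * F.ghost b * (F.path c * F.path m)) * F.ghost m := by
    conv_lhs => rw [hb, hc, Finset.sum_mul_sum]
    simp only [mul_assoc]
  rw [hexpand]
  refine sum_mem fun l hl => sum_mem fun m hm => ?_
  obtain ⟨hlb, hld⟩ := (hfin _ _).mem_toFinset.1 hl
  obtain ⟨hmc, hmd⟩ := (hfin _ _).mem_toFinset.1 hm
  rw [F.ghost_mul_ghost b l hlb, F.path_mul_path c m hmc]
  obtain heq | hne := eq_or_ne (b.comp l hlb) (c.comp m hmc)
  · rw [← heq, F.ghost_mul_path_self, Path.comp_source, F.path_mul_source]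
    exact hN l m hlb hmc heq
  · have hdeg : (b.comp l hlb).deg = (c.comp m hmc).deg := by
      rw [Path.deg_comp, Path.deg_comp, hld, hmd, add_tsub_cancel_of_le le_sup_left,
        add_tsub_cancel_of_le le_sup_right]
    rw [F.ghost_mul_path_of_ne hdeg hne, mul_zero, zero_mul]
    exact zero_mem N

theorem component_eq_span (n : ℕ →₀ ℤ) : F.component R n =
    Submodule.span R {c | ∃ a b : Path Λ, a.intDeg - b.intDeg = n ∧ c = F.path a * F.ghost b} := by
  simp only [component, Finsupp.ext_iff, Finsupp.sub_apply, Path.intDeg_apply]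

theorem path_mul_ghost_mem_component {a b : Path Λ} {n : ℕ →₀ ℤ} (h : a.intDeg - b.intDeg = n) :
    F.path a * F.ghost b ∈ F.component R n := by
  rw [component_eq_span]
  exact Submodule.subset_span ⟨a, b, h, rfl⟩

theorem path_mem_component (l : Path Λ) : F.path l ∈ F.component R l.intDeg := by
  rw [← F.path_mul_source l, ← F.ghost_vertex]
  exact F.path_mul_ghost_mem_component (by simp)

theorem ghost_mem_component (l : Path Λ) : F.ghost l ∈ F.component R (-l.intDeg) := by
  rw [← F.source_mul_ghost l, ← F.path_vertex]
  exact F.path_mul_ghost_mem_component (by simp)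

theorem path_mul_ghost_mul_path_mul_ghost_mem_component (hfin : RowFinite Λ) (a b c e : Path Λ) :
    F.path a * F.ghost b * (F.path c * F.ghost e) ∈
      F.component R (a.intDeg - b.intDeg + (c.intDeg - e.intDeg)) := by
  rw [mul_assoc, ← mul_assoc (F.ghost b)]
  refine F.ghost_mul_path_mem hfin (N := (F.component R _).toAddSubmonoid.comap
    ((AddMonoidHom.mulLeft (F.path a)).comp (AddMonoidHom.mulRight (F.ghost e)))) ?_
  intro l m hl hm hlm
  change F.path a * (F.path l * F.ghost m * F.ghost e) ∈ F.component R _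
  rw [mul_assoc, ← mul_assoc]
  by_cases hal : l.range = a.source
  · by_cases hem : m.range = e.source
    · rw [F.path_mul_path a l hal, F.ghost_mul_ghost e m hem]
      refine F.path_mul_ghost_mem_component ?_
      have hdeg : b.intDeg + l.intDeg = c.intDeg + m.intDeg := by
        simpa using congrArg Path.intDeg hlm
      rw [Path.intDeg_comp, Path.intDeg_comp, eq_sub_of_add_eq' hdeg]
      abel
    · rw [F.ghost_mul_ghost_of_ne hem, mul_zero]
      exact zero_mem _
  · rw [F.path_mul_path_of_ne hal, zero_mul]
    exact zero_mem _

variable [IsScalarTower R A A] [SMulCommClass R A A]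

theorem mul_mem_component (hfin : RowFinite Λ) {m n : ℕ →₀ ℤ} {a b : A}
    (ha : a ∈ F.component R m) (hb : b ∈ F.component R n) : a * b ∈ F.component R (m + n) := by
  have hle : Submodule.map₂ (LinearMap.mul R A) (F.component R m) (F.component R n) ≤
      F.component R (m + n) := by
    rw [F.component_eq_span m, F.component_eq_span n, Submodule.map₂_span_span, Submodule.span_le]
    rintro _ ⟨_, ⟨a, b, rfl, rfl⟩, _, ⟨c, e, rfl, rfl⟩, rfl⟩
    exact F.path_mul_ghost_mul_path_mul_ghost_mem_component hfin a b c e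
  exact hle (Submodule.apply_mem_map₂ (LinearMap.mul R A) ha hb)

theorem mul_mem_iSup_component (hfin : RowFinite Λ) {a b : A} (ha : a ∈ ⨆ n, F.component R n)
    (hb : b ∈ ⨆ n, F.component R n) : a * b ∈ ⨆ n, F.component R n := by
  have hle : Submodule.map₂ (LinearMap.mul R A) (⨆ n, F.component R n) (⨆ n, F.component R n) ≤
      ⨆ n, F.component R n := by
    simp only [Submodule.map₂_iSup_left, Submodule.map₂_iSup_right, iSup_le_iff, Submodule.map₂_le]
    exact fun m n a ha b hb => Submodule.mem_iSup_of_mem _ (F.mul_mem_component hfin ha hb)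
  exact hle (Submodule.apply_mem_map₂ (LinearMap.mul R A) ha hb)

variable {F}

theorem Generates.iSup_component_eq_top (hF : F.Generates R) (hfin : RowFinite Λ) :
    ⨆ n, F.component R n = ⊤ := by
  let N : NonUnitalSubalgebra R A :=
    { ⨆ n, F.component R n with mul_mem' := F.mul_mem_iSup_component hfin }
  have hN : NonUnitalAlgebra.adjoin R (Set.range F.path ∪ Set.range F.ghost) ≤ N := by
    refine NonUnitalAlgebra.adjoin_le ?_
    rintro _ (⟨l, rfl⟩ | ⟨l, rfl⟩)
    exacts [Submodule.mem_iSup_of_mem _ (F.path_mem_component l),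
      Submodule.mem_iSup_of_mem _ (F.ghost_mem_component l)]
  rw [generates_iff_adjoin_path_ghost.1 hF] at hN
  exact Submodule.eq_top_iff'.2 fun a => hN (NonUnitalAlgebra.mem_top (x := a))

end Grading

section Twist

variable {R : Type t} [CommRing R] {A : Type w} [NonUnitalRing A] [Module R A]
  [IsScalarTower R A A] [SMulCommClass R A A] (F : KumjianPaskFamily Λ A)

variable (R) in
theorem isKumjianPask_single (hfin : RowFinite Λ) : IsKumjianPask
    (fun l => AddMonoidAlgebra.single l.intDeg (F.path l : Unitization R A))
    (fun l => AddMonoidAlgebra.single (-l.intDeg) (F.ghost l : Unitization R A)) where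
  path_mul_path l m h := by
    rw [AddMonoidAlgebra.single_mul_single, ← Unitization.inr_mul, F.path_mul_path l m h,
      Path.intDeg_comp]
  ghost_mul_ghost l m h := by
    rw [AddMonoidAlgebra.single_mul_single, ← Unitization.inr_mul, F.ghost_mul_ghost l m h,
      Path.intDeg_comp, neg_add_rev]
  ghost_vertex x := by rw [F.ghost_vertex, F.path_vertex, Path.intDeg_vertex, neg_zero]
  ghost_mul_path_self l := by
    rw [AddMonoidAlgebra.single_mul_single, ← Unitization.inr_mul, F.ghost_mul_path_self,
      F.path_vertex, Path.intDeg_vertex, neg_add_cancel]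
  ghost_mul_path_of_ne l m hd hne := by
    rw [AddMonoidAlgebra.single_mul_single, ← Unitization.inr_mul, F.ghost_mul_path_of_ne hd hne,
      Unitization.inr_zero, AddMonoidAlgebra.single_zero]
  vertex_eq_finsum x n := by
    let j : A →+ AddMonoidAlgebra (Unitization R A) (ℕ →₀ ℤ) :=
      (AddMonoidAlgebra.singleAddHom 0).comp
        (AddMonoidHomClass.toAddMonoidHom (Unitization.inrNonUnitalAlgHom R A))
    have hj : ∀ l, j (F.path l * F.ghost l) =
        AddMonoidAlgebra.single l.intDeg (F.path l : Unitization R A) *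
          AddMonoidAlgebra.single (-l.intDeg) (F.ghost l : Unitization R A) := fun l => by
      rw [AddMonoidAlgebra.single_mul_single, add_neg_cancel, ← Unitization.inr_mul]
      rfl
    rw [F.path_vertex, Path.intDeg_vertex, ← finsum_mem_congr rfl fun l _ => hj l,
      ← j.map_finsum_mem _ (hfin x n), ← P_eq_finsum]
    rfl

variable {F}

theorem IsUniversal.iSupIndep_component (hF : IsUniversal.{u, v, max t w} R F)
    (hfin : RowFinite Λ) : iSupIndep (F.component R) := by
  obtain ⟨f, hf, -⟩ := hF _ (F.isKumjianPask_single R hfin).toFamily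
  rw [mapsTo_toFamily] at hf
  have hsingle : ∀ n, F.component R n ≤ LinearMap.eqLocus (f : A →ₗ[R] _)
      (AddMonoidAlgebra.lsingle n ∘ₗ Unitization.inrHom R R A) := by
    intro n
    rw [component_eq_span, Submodule.span_le]
    rintro _ ⟨a, b, rfl, rfl⟩
    change f (F.path a * F.ghost b) = .single _ ((F.path a * F.ghost b : A) : Unitization R A)
    rw [map_mul, hf.1, hf.2, AddMonoidAlgebra.single_mul_single, ← sub_eq_add_neg,
      Unitization.inr_mul]
  refine iSupIndep_of_forall_eq_single (j := fun a => (a : Unitization R A))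
    ((AddMonoidAlgebra.coeffLinearEquiv R).toLinearMap ∘ₗ (f : A →ₗ[R] _))
    (fun a ha => Unitization.inr_injective ha) fun n a ha => ?_
  exact congrArg AddMonoidAlgebra.coeff (hsingle n ha)

end Twist

end KumjianPaskFamily

namespace NGraph

section Pullback

variable (R : Type*) [Semiring R] {α β γ : Type*}

/-- The linear map `f ↦ f ∘ σ` for a partial bijection `σ`, extended by zero to the points where
`σ` is undefined. -/
def pullback (σ : α ≃. β) : (β → R) →ₗ[R] (α → R) where
  toFun f a := (σ a).elim 0 f
  map_add' f g := by
    ext a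
    cases h : σ a <;> simp [h]
  map_smul' r f := by
    ext a
    cases h : σ a <;> simp [h]

theorem pullback_apply (σ : α ≃. β) (f : β → R) (a : α) :
    pullback R σ f a = (σ a).elim 0 f := rfl

theorem pullback_pullback (σ : α ≃. β) (τ : β ≃. γ) (f : γ → R) :
    pullback R σ (pullback R τ f) = pullback R (σ.trans τ) f := by
  ext a
  change (σ a).elim 0 (fun b => (τ b).elim 0 f) = ((σ a).bind τ).elim 0 f
  cases σ a <;> rfl

open scoped Classical in
theorem pullback_ofSet (s : Set α) (f : α → R) :
    pullback R (PEquiv.ofSet s) f = s.indicator f := by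
  ext a
  by_cases ha : a ∈ s <;> simp [pullback_apply, PEquiv.ofSet, ha]

end Pullback

variable {Λ : Type u} [NGraph.{u, v} Λ]

namespace Path

open scoped Classical in
/-- The partial bijection `p ↦ l p` of the paths, defined where `p.range = l.source`. -/
noncomputable def prepend (l : Path Λ) : Path Λ ≃. Path Λ where
  toFun p := if h : p.range = l.source then some (l.comp p h) else none
  invFun q := if h : ∃ p hp, l.comp p hp = q then some h.choose else none
  inv p q := by
    simp only [Option.dite_none_right_eq_some, Option.some.injEq]
    constructor
    · rintro ⟨h, rfl⟩
      exact h.choose_spec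
    · rintro ⟨h, rfl⟩
      have hex : ∃ p' hp', l.comp p' hp' = l.comp p h := ⟨p, h, rfl⟩
      exact ⟨hex, (comp_inj_of_deg_eq rfl hex.choose_spec.choose_spec).2⟩

theorem mem_prepend {l p q : Path Λ} : q ∈ prepend l p ↔ ∃ h, l.comp p h = q := by
  simp [prepend]

theorem prepend_trans_prepend (l m : Path Λ) (h : m.range = l.source) :
    (prepend m).trans (prepend l) = prepend (l.comp m h) := by
  refine PEquiv.ext fun p => Option.ext fun q => ?_
  simp only [← Option.mem_def, PEquiv.mem_trans, mem_prepend]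
  constructor
  · rintro ⟨_, ⟨hp, rfl⟩, h', rfl⟩
    exact ⟨hp, comp_assoc l m p h hp⟩
  · rintro ⟨hp, rfl⟩
    exact ⟨m.comp p hp, ⟨hp, rfl⟩, h, (comp_assoc l m p h hp).symm⟩

open scoped Classical in
theorem prepend_vertex (x : Λ) : prepend (vertex x) = PEquiv.ofSet {p | p.range = x} := by
  refine PEquiv.ext fun p => Option.ext fun q => ?_
  rw [← Option.mem_def, ← Option.mem_def, mem_prepend, PEquiv.mem_ofSet_iff]
  constructor
  · rintro ⟨h, rfl⟩
    obtain rfl : p.range = x := h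
    exact ⟨vertex_comp p, rfl⟩
  · rintro ⟨rfl, h⟩
    obtain rfl : q.range = x := h
    exact ⟨rfl, vertex_comp q⟩

theorem symm_prepend_vertex (x : Λ) : (prepend (vertex x)).symm = prepend (vertex x) := by
  classical rw [prepend_vertex, PEquiv.ofSet_symm]

theorem prepend_trans_symm_self (l : Path Λ) :
    (prepend l).trans (prepend l).symm = prepend (vertex l.source) := by
  classical
  have hdom : {p | (prepend l p).isSome} = {p : Path Λ | p.range = l.source} := by
    ext p
    simp [prepend]
  simp only [PEquiv.self_trans_symm, prepend_vertex, hdom]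

theorem prepend_trans_symm_of_ne {l m : Path Λ} (hd : l.deg = m.deg) (hne : l ≠ m) :
    (prepend l).trans (prepend m).symm = ⊥ := by
  refine PEquiv.ext fun p => Option.eq_none_iff_forall_not_mem.2 fun q hq => ?_
  obtain ⟨r, hr, hr'⟩ := (PEquiv.mem_trans ..).1 hq
  obtain ⟨_, rfl⟩ := mem_prepend.1 hr
  obtain ⟨_, h⟩ := mem_prepend.1 ((PEquiv.mem_iff_mem _).1 hr')
  exact hne (comp_inj_of_deg_eq hd h.symm).1

/-- The paths of the form `l p`, that is, the extensions of `l`. -/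
def cylinder (l : Path Λ) : Set (Path Λ) := {q | ∃ p h, l.comp p h = q}

open scoped Classical in
theorem symm_prepend_trans_prepend (l : Path Λ) :
    (prepend l).symm.trans (prepend l) = PEquiv.ofSet l.cylinder := by
  have hran : {q | ((prepend l).symm q).isSome} = l.cylinder := by
    ext q
    simp [Option.isSome_iff_exists, ← Option.mem_def, PEquiv.mem_iff_mem, mem_prepend, cylinder]
  simp only [PEquiv.symm_trans_self, hran]

theorem deg_of_mem_prepend {l p q : Path Λ} (h : q ∈ prepend l p) : q.deg = l.deg + p.deg := by
  obtain ⟨hp, rfl⟩ := mem_prepend.1 h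
  exact deg_comp l p hp

theorem sum_indicator_cylinder (hfin : RowFinite Λ) (x : Λ) {n : ℕ →₀ ℕ} {M : Type*}
    [AddCommMonoid M] (f : Path Λ → M) {p : Path Λ} (hp : n ≤ p.deg) :
    ∑ l ∈ (hfin x n).toFinset, l.cylinder.indicator f p = {q | q.range = x}.indicator f p := by
  obtain ⟨a, b, hab, ha, -, rfl⟩ := p.exists_comp_eq (add_tsub_cancel_of_le hp).symm
  have hne : ∀ l ∈ (hfin x n).toFinset, l ≠ a → l.cylinder.indicator f (a.comp b hab) = 0 := by
    refine fun l hl hla => Set.indicator_of_notMem ?_ f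
    rintro ⟨q, hq, he⟩
    have hd : l.deg = a.deg := ((hfin x n).mem_toFinset.1 hl).2.trans ha.symm
    exact hla (comp_inj_of_deg_eq hd he).1
  by_cases hx : a.range = x
  · have hmem : a ∈ (hfin x n).toFinset := (hfin x n).mem_toFinset.2 ⟨hx, ha⟩
    have hcyl : a.comp b hab ∈ a.cylinder := ⟨b, hab, rfl⟩
    have hran : a.comp b hab ∈ {q : Path Λ | q.range = x} := hx
    rw [Finset.sum_eq_single_of_mem a hmem hne, Set.indicator_of_mem hcyl,
      Set.indicator_of_mem hran]
  · have hran : a.comp b hab ∉ {q : Path Λ | q.range = x} := hx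
    rw [Set.indicator_of_notMem hran]
    exact Finset.sum_eq_zero fun l hl => hne l hl <| by
      rintro rfl
      exact hx ((hfin x n).mem_toFinset.1 hl).1

end Path

section Germs

variable (Λ) (R : Type t) [CommRing R]

/-- The functions that vanish on all paths of sufficiently large degree. -/
def eventuallyZero : Submodule R (Path Λ → R) where
  carrier := {f | ∃ n, ∀ p : Path Λ, n ≤ p.deg → f p = 0}
  add_mem' := by
    rintro f g ⟨m, hm⟩ ⟨n, hn⟩
    refine ⟨m ⊔ n, fun p hp => ?_⟩
    rw [Pi.add_apply, hm p (le_sup_left.trans hp), hn p (le_sup_right.trans hp), add_zero]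
  zero_mem' := ⟨0, fun _ _ => rfl⟩
  smul_mem' := by
    rintro r f ⟨n, hn⟩
    exact ⟨n, fun p hp => by rw [Pi.smul_apply, hn p hp, smul_zero]⟩

/-- The module of germs at infinity of functions on paths. -/
abbrev Germs : Type (max u v t) := (Path Λ → R) ⧸ eventuallyZero Λ R

variable {Λ R}

theorem eventuallyZero_le_comap_pullback {σ : Path Λ ≃. Path Λ} (m : ℕ →₀ ℕ)
    (hσ : ∀ p q, q ∈ σ p → p.deg ≤ m + q.deg) :
    eventuallyZero Λ R ≤ (eventuallyZero Λ R).comap (pullback R σ) := by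
  rintro f ⟨n, hn⟩
  refine ⟨m + n, fun p hp => ?_⟩
  rw [pullback_apply]
  cases h : σ p with
  | none => rfl
  | some q => exact hn q (le_of_add_le_add_left (hp.trans (hσ p q h)))

variable (R)

/-- The operator `f ↦ (l p ↦ f p)` on germs, by which the path `l` acts. -/
noncomputable def germPath (l : Path Λ) : Module.End R (Germs Λ R) :=
  (eventuallyZero Λ R).mapQ _ (pullback R l.prepend.symm) <|
    eventuallyZero_le_comap_pullback l.deg fun _ _ h =>
      (Path.deg_of_mem_prepend ((PEquiv.mem_iff_mem _).1 h)).le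

/-- The operator `f ↦ (p ↦ f (l p))` on germs, by which the ghost path of `l` acts. -/
noncomputable def germGhost (l : Path Λ) : Module.End R (Germs Λ R) :=
  (eventuallyZero Λ R).mapQ _ (pullback R l.prepend) <|
    eventuallyZero_le_comap_pullback 0 fun _ _ h => by
      rw [Path.deg_of_mem_prepend h, zero_add]
      exact le_add_self

theorem germPath_mk (l : Path Λ) (f : Path Λ → R) :
    germPath R l (Submodule.Quotient.mk f) =
      Submodule.Quotient.mk (pullback R l.prepend.symm f) := rfl

theorem germGhost_mk (l : Path Λ) (f : Path Λ → R) :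
    germGhost R l (Submodule.Quotient.mk f) = Submodule.Quotient.mk (pullback R l.prepend f) :=
  rfl

theorem germPath_vertex_mk (x : Λ) (f : Path Λ → R) :
    germPath R (.vertex x) (Submodule.Quotient.mk f) =
      Submodule.Quotient.mk ({p | p.range = x}.indicator f) := by
  classical rw [germPath_mk, Path.symm_prepend_vertex, Path.prepend_vertex, pullback_ofSet]

theorem germPath_germGhost_mk (l : Path Λ) (f : Path Λ → R) :
    germPath R l (germGhost R l (Submodule.Quotient.mk f)) =
      Submodule.Quotient.mk (l.cylinder.indicator f) := by
  classical
  rw [germGhost_mk, germPath_mk, pullback_pullback, Path.symm_prepend_trans_prepend, pullback_ofSet]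

variable {R} in
theorem germs_end_ext {S T : Module.End R (Germs Λ R)}
    (h : ∀ f, S (Submodule.Quotient.mk f) = T (Submodule.Quotient.mk f)) : S = T :=
  Submodule.linearMap_qext _ (LinearMap.ext h)

theorem germPath_vertex_eq_sum (hfin : RowFinite Λ) (x : Λ) (n : ℕ →₀ ℕ) :
    germPath R (.vertex x) = ∑ l ∈ (hfin x n).toFinset, germPath R l * germGhost R l := by
  refine germs_end_ext fun f => ?_
  have hsum : (∑ l ∈ (hfin x n).toFinset, germPath R l * germGhost R l) (Submodule.Quotient.mk f) =
      Submodule.Quotient.mk (∑ l ∈ (hfin x n).toFinset, l.cylinder.indicator f) := by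
    rw [LinearMap.sum_apply]
    exact (Finset.sum_congr rfl fun l _ => germPath_germGhost_mk R l f).trans
      (map_sum (eventuallyZero Λ R).mkQ _ _).symm
  rw [hsum, germPath_vertex_mk, Submodule.Quotient.eq]
  refine ⟨n, fun p hp => ?_⟩
  rw [Pi.sub_apply, Finset.sum_apply, Path.sum_indicator_cylinder hfin x f hp, sub_self]

theorem isKumjianPask_germ (hfin : RowFinite Λ) :
    IsKumjianPask (germPath (Λ := Λ) R) (germGhost R) where
  path_mul_path l m h := germs_end_ext fun f => by
    rw [Module.End.mul_apply, germPath_mk, germPath_mk, germPath_mk, pullback_pullback,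
      ← PEquiv.symm_trans_rev, Path.prepend_trans_prepend l m h]
  ghost_mul_ghost l m h := germs_end_ext fun f => by
    rw [Module.End.mul_apply, germGhost_mk, germGhost_mk, germGhost_mk, pullback_pullback,
      Path.prepend_trans_prepend l m h]
  ghost_vertex x := germs_end_ext fun f => by
    rw [germGhost_mk, germPath_mk, Path.symm_prepend_vertex]
  ghost_mul_path_self l := germs_end_ext fun f => by
    rw [Module.End.mul_apply, germPath_mk, germGhost_mk, germPath_mk, pullback_pullback,
      Path.prepend_trans_symm_self, Path.symm_prepend_vertex]
  ghost_mul_path_of_ne l m hd hne := germs_end_ext fun f => by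
    rw [Module.End.mul_apply, germPath_mk, germGhost_mk, pullback_pullback,
      Path.prepend_trans_symm_of_ne hd hne]
    rfl
  vertex_eq_finsum x n := by
    rw [finsum_mem_eq_finite_toFinset_sum _ (hfin x n), germPath_vertex_eq_sum R hfin x n]

variable {R}

theorem smul_germPath_vertex_ne_zero (hsrc : NoSources Λ) {r : R} (hr : r ≠ 0) (x : Λ) :
    r • germPath R (.vertex x) ≠ 0 := by
  intro h
  have hone : r • germPath R (.vertex x) (Submodule.Quotient.mk 1) = 0 := LinearMap.congr_fun h _
  rw [germPath_vertex_mk, ← Submodule.Quotient.mk_smul, Submodule.Quotient.mk_eq_zero] at hone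
  obtain ⟨n, hn⟩ := hone
  obtain ⟨p, hpx, hpn⟩ := hsrc x n
  simpa [hpx, hr] using hn p hpn.ge

end Germs

section Universal

variable (R : Type t) [CommRing R]

/-- The Kumjian–Pask relations in the free unital algebra whose generators are the paths (`inl`)
and the ghost paths (`inr`), vertices included. -/
inductive KumjianPaskRel :
    FreeAlgebra R (Path Λ ⊕ Path Λ) → FreeAlgebra R (Path Λ ⊕ Path Λ) → Prop
  | path_mul_path (l m : Path Λ) (h : m.range = l.source) : KumjianPaskRel
      (FreeAlgebra.ι R (.inl l) * FreeAlgebra.ι R (.inl m)) (FreeAlgebra.ι R (.inl (l.comp m h)))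
  | ghost_mul_ghost (l m : Path Λ) (h : m.range = l.source) : KumjianPaskRel
      (FreeAlgebra.ι R (.inr m) * FreeAlgebra.ι R (.inr l)) (FreeAlgebra.ι R (.inr (l.comp m h)))
  | ghost_vertex (x : Λ) : KumjianPaskRel
      (FreeAlgebra.ι R (.inr (.vertex x))) (FreeAlgebra.ι R (.inl (.vertex x)))
  | ghost_mul_path_self (l : Path Λ) : KumjianPaskRel
      (FreeAlgebra.ι R (.inr l) * FreeAlgebra.ι R (.inl l))
      (FreeAlgebra.ι R (.inl (.vertex l.source)))
  | ghost_mul_path_of_ne (l m : Path Λ) (hd : l.deg = m.deg) (hne : l ≠ m) : KumjianPaskRel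
      (FreeAlgebra.ι R (.inr l) * FreeAlgebra.ι R (.inl m)) 0
  | vertex_eq_finsum (x : Λ) (n : ℕ →₀ ℕ) : KumjianPaskRel
      (FreeAlgebra.ι R (.inl (.vertex x)))
      (∑ᶠ l ∈ pathsInto x n, FreeAlgebra.ι R (.inl l) * FreeAlgebra.ι R (.inr l))

/-- The image of the path `l` in the universal unital algebra for the Kumjian–Pask relations. -/
noncomputable def unitalPath (l : Path Λ) : RingQuot (KumjianPaskRel (Λ := Λ) R) :=
  RingQuot.mkAlgHom R _ (FreeAlgebra.ι R (.inl l))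

/-- The image of the ghost path of `l` in the universal unital algebra for the Kumjian–Pask
relations. -/
noncomputable def unitalGhost (l : Path Λ) : RingQuot (KumjianPaskRel (Λ := Λ) R) :=
  RingQuot.mkAlgHom R _ (FreeAlgebra.ι R (.inr l))

theorem isKumjianPask_unital (hfin : RowFinite Λ) :
    IsKumjianPask (unitalPath (Λ := Λ) R) (unitalGhost R) where
  path_mul_path l m h := (map_mul ..).symm.trans <| RingQuot.mkAlgHom_rel R (.path_mul_path l m h)
  ghost_mul_ghost l m h :=
    (map_mul ..).symm.trans <| RingQuot.mkAlgHom_rel R (.ghost_mul_ghost l m h)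
  ghost_vertex x := RingQuot.mkAlgHom_rel R (.ghost_vertex x)
  ghost_mul_path_self l :=
    (map_mul ..).symm.trans <| RingQuot.mkAlgHom_rel R (.ghost_mul_path_self l)
  ghost_mul_path_of_ne l m hd hne := (map_mul ..).symm.trans <|
    (RingQuot.mkAlgHom_rel R (.ghost_mul_path_of_ne l m hd hne)).trans (map_zero _)
  vertex_eq_finsum x n := (RingQuot.mkAlgHom_rel R (.vertex_eq_finsum x n)).trans <|
    ((RingQuot.mkAlgHom R (KumjianPaskRel R)).toAddMonoidHom.map_finsum_mem _ (hfin x n)).trans <|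
      finsum_mem_congr rfl fun _ _ => map_mul (RingQuot.mkAlgHom R (KumjianPaskRel R)) ..

variable {R}

theorem IsKumjianPask.lift_eq_of_kumjianPaskRel (hfin : RowFinite Λ) {A : Type*} [Ring A]
    [Algebra R A] {s s' : Path Λ → A} (h : IsKumjianPask s s')
    {a b : FreeAlgebra R (Path Λ ⊕ Path Λ)} (hab : KumjianPaskRel R a b) :
    FreeAlgebra.lift R (Sum.elim s s') a = FreeAlgebra.lift R (Sum.elim s s') b := by
  cases hab with
  | path_mul_path l m hlm => simpa using h.path_mul_path l m hlm
  | ghost_mul_ghost l m hlm => simpa using h.ghost_mul_ghost l m hlm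
  | ghost_vertex x => simpa using h.ghost_vertex x
  | ghost_mul_path_self l => simpa using h.ghost_mul_path_self l
  | ghost_mul_path_of_ne l m hd hne => simpa using h.ghost_mul_path_of_ne l m hd hne
  | vertex_eq_finsum x n =>
    refine Eq.trans ?_ ((FreeAlgebra.lift R (Sum.elim s s')).toAddMonoidHom.map_finsum_mem _
      (hfin x n)).symm
    simpa using h.vertex_eq_finsum x n

theorem IsKumjianPask.exists_unital_lift (hfin : RowFinite Λ) {A : Type*} [Ring A] [Algebra R A]
    {s s' : Path Λ → A} (h : IsKumjianPask s s') :
    ∃ f : RingQuot (KumjianPaskRel (Λ := Λ) R) →ₐ[R] A,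
      (∀ l, f (unitalPath R l) = s l) ∧ ∀ l, f (unitalGhost R l) = s' l := by
  refine ⟨RingQuot.liftAlgHom R ⟨FreeAlgebra.lift R (Sum.elim s s'),
    fun _ _ => h.lift_eq_of_kumjianPaskRel hfin⟩, fun l => ?_, fun l => ?_⟩
  · simp [unitalPath]
  · simp [unitalGhost]

variable (Λ R) in
/-- The Kumjian–Pask algebra: the subalgebra, in general without unit, that the paths and ghost
paths generate in the universal unital algebra for the Kumjian–Pask relations. -/
abbrev KumjianPaskAlgebra : Type (max u v t) :=
  NonUnitalAlgebra.adjoin R (Set.range (unitalPath (Λ := Λ) R) ∪ Set.range (unitalGhost R))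

namespace KumjianPaskAlgebra

variable (R) in
/-- The path `l` as an element of the Kumjian–Pask algebra. -/
noncomputable def path (l : Path Λ) : KumjianPaskAlgebra Λ R :=
  ⟨unitalPath R l, NonUnitalAlgebra.subset_adjoin R (.inl ⟨l, rfl⟩)⟩

variable (R) in
/-- The ghost path of `l` as an element of the Kumjian–Pask algebra. -/
noncomputable def ghost (l : Path Λ) : KumjianPaskAlgebra Λ R :=
  ⟨unitalGhost R l, NonUnitalAlgebra.subset_adjoin R (.inr ⟨l, rfl⟩)⟩

variable (R) in
theorem isKumjianPask (hfin : RowFinite Λ) : IsKumjianPask (path (Λ := Λ) R) (ghost R) :=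
  .of_injective hfin (NonUnitalSubalgebraClass.subtype (NonUnitalAlgebra.adjoin R _))
    Subtype.val_injective (isKumjianPask_unital R hfin)

variable (R) in
/-- The universal Kumjian–Pask family. -/
noncomputable def family (hfin : RowFinite Λ) : KumjianPaskFamily Λ (KumjianPaskAlgebra Λ R) :=
  (isKumjianPask R hfin).toFamily

theorem family_path (hfin : RowFinite Λ) (l : Path Λ) : (family R hfin).path l = path R l :=
  (isKumjianPask R hfin).path_toFamily l

theorem family_ghost (hfin : RowFinite Λ) (l : Path Λ) : (family R hfin).ghost l = ghost R l :=
  (isKumjianPask R hfin).ghost_toFamily l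

theorem family_generates (hfin : RowFinite Λ) : (family (Λ := Λ) R hfin).Generates R := by
  rw [KumjianPaskFamily.generates_iff_adjoin_path_ghost, ← top_le_iff,
    ← adjoin_preimage_coe_eq_top]
  refine NonUnitalAlgebra.adjoin_mono ?_
  rintro ⟨_, _⟩ (⟨l, rfl⟩ | ⟨l, rfl⟩)
  exacts [.inl ⟨l, family_path hfin l⟩, .inr ⟨l, family_ghost hfin l⟩]

theorem exists_lift (hfin : RowFinite Λ) {A : Type*} [NonUnitalRing A] [Module R A]
    [IsScalarTower R A A] [SMulCommClass R A A] (G : KumjianPaskFamily Λ A) :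
    ∃ f : KumjianPaskAlgebra Λ R →ₙₐ[R] A, (family R hfin).MapsTo G f := by
  obtain ⟨φ, hpath, hghost⟩ := IsKumjianPask.exists_unital_lift (R := R) hfin <|
    G.isKumjianPask.map hfin (Unitization.inrNonUnitalAlgHom R A)
  let ψ : KumjianPaskAlgebra Λ R →ₙₐ[R] Unitization R A :=
    (φ : _ →ₙₐ[R] Unitization R A).comp (NonUnitalSubalgebraClass.subtype _)
  have hψpath : ∀ l, ψ ((family R hfin).path l) = (G.path l : Unitization R A) := fun l =>
    (congrArg ψ (family_path hfin l)).trans (hpath l)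
  have hψghost : ∀ l, ψ ((family R hfin).ghost l) = (G.ghost l : Unitization R A) := fun l =>
    (congrArg ψ (family_ghost hfin l)).trans (hghost l)
  have hfst : ((Unitization.fstHom R A : _ →ₙₐ[R] R).comp ψ) = 0 :=
    (family_generates hfin).hom_ext (fun l => congrArg (Unitization.fstHom R A) (hψpath l))
      fun l => congrArg (Unitization.fstHom R A) (hψghost l)
  obtain ⟨f, hf⟩ := exists_inr_eq_of_fst_eq_zero ψ fun a => DFunLike.congr_fun hfst a
  exact ⟨f, KumjianPaskFamily.mapsTo_iff.2
    ⟨fun l => Unitization.inr_injective ((hf _).trans (hψpath l)),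
      fun l => Unitization.inr_injective ((hf _).trans (hψghost l))⟩⟩

theorem family_isUniversal (hfin : RowFinite Λ) :
    (family (Λ := Λ) R hfin).IsUniversal.{u, v, w} R := by
  intro A _ _ _ _ G
  obtain ⟨f, hf⟩ := exists_lift (R := R) hfin G
  exact ⟨f, hf, fun g hg => (family_generates hfin).mapsTo_unique hg hf⟩

theorem smul_family_P_ne_zero (hfin : RowFinite Λ) (hsrc : NoSources Λ) {r : R} (hr : r ≠ 0)
    (x : Λ) : r • (family R hfin).P x ≠ 0 := by
  intro h
  obtain ⟨f, hf⟩ := exists_lift (R := R) hfin (isKumjianPask_germ R hfin).toFamily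
  have hvertex : f ((family R hfin).P x) = germPath R (.vertex x) := hf.1 x
  refine smul_germPath_vertex_ne_zero hsrc hr x ?_
  rw [← hvertex, ← map_smul, h, map_zero]

end KumjianPaskAlgebra

end Universal

end NGraph

theorem mainTheorem9 (Λ : Type u) [NGraph.{u, v} Λ] (hfin : NGraph.RowFinite Λ)
    (hsrc : NGraph.NoSources Λ) (R : Type t) [CommRing R] :
    ∃ (K : Type (max u v t)) (_ : NonUnitalRing K) (_ : Module R K) (_ : IsScalarTower R K K)
      (_ : SMulCommClass R K K) (F : KumjianPaskFamily Λ K),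
      -- the family generates the algebra and is universal
      F.Generates R ∧
      KumjianPaskFamily.IsUniversal.{u, v, max u v t w} R F ∧
      -- the algebra with its family is unique up to a unique compatible isomorphism
      (∀ (B : Type (max u v t w)) [NonUnitalRing B] [Module R B] [IsScalarTower R B B]
        [SMulCommClass R B B] (G : KumjianPaskFamily Λ B),
        G.Generates R → KumjianPaskFamily.IsUniversal.{u, v, max u v t w} R G →
          ∃! f : K →ₙₐ[R] B, Function.Bijective f ∧ F.MapsTo G f) ∧
      -- nonzero multiples of the vertex idempotents are nonzero
      (∀ (r : R) (x : Λ), r ≠ 0 → r • F.P x ≠ 0) ∧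
      -- the spans form a grading
      (∀ (m n : ℕ →₀ ℤ), ∀ a ∈ F.component R m, ∀ b ∈ F.component R n,
        a * b ∈ F.component R (m + n)) ∧
      DirectSum.IsInternal (F.component R) := by
  have hgen := KumjianPaskAlgebra.family_generates (R := R) hfin
  refine ⟨KumjianPaskAlgebra Λ R, inferInstance, inferInstance, inferInstance, inferInstance,
    KumjianPaskAlgebra.family R hfin, hgen, KumjianPaskAlgebra.family_isUniversal hfin, ?_,
    fun r x hr => KumjianPaskAlgebra.smul_family_P_ne_zero hfin hsrc hr x,
    fun m n a ha b hb => KumjianPaskFamily.mul_mem_component _ hfin ha hb, ?_⟩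
  · intro B _ _ _ _ G hG hGuniv
    obtain ⟨f, hf⟩ := KumjianPaskAlgebra.exists_lift (R := R) hfin G
    exact ⟨f, ⟨⟨hGuniv.injective hfin hgen hf, hG.surjective hf⟩, hf⟩,
      fun g hg => hgen.mapsTo_unique hg.2 hf⟩
  · exact (DirectSum.isInternal_submodule_iff_iSupIndep_and_iSup_eq_top _).2
      ⟨(KumjianPaskAlgebra.family_isUniversal hfin).iSupIndep_component hfin,
        hgen.iSup_component_eq_top hfin⟩
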